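/- A Schröder path of length $2n$ is a lattice path from $(0,0)$ to $(2n,0)$ that consists of steps $U=(1,1)$, $D=(1,-1)$ and $F=(2,0)$ and never goes below the $x$-axis. An ascent of such a path is a maximal nonempty string of consecutive up-steps $U$. For $n\ge 0$ let $X_n$ be the number of ascents of a Schröder path of length $2n$ chosen uniformly at random among all Schröder paths of length $2n$. Then $$\mathbb{E}(X_n)\sim(\sqrt2-1)\,n\qquad\text{as } n\to\infty,$$ that is, $\lim_{n\to\infty}\mathbb{E}(X_n)/n=\sqrt2-1$. -/

import Mathlib

open MeasureTheory Filter Asymptotics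

/-- The three steps of Schroeder paths: up, down and flat. -/
inductive SchroederStep : Type
  | U : SchroederStep
  | D : SchroederStep
  | F : SchroederStep

namespace SchroederStep

/-- The vector of a step: `U = (1, 1)`, `D = (1, -1)`, `F = (2, 0)`. -/
def vec : SchroederStep → ℤ × ℤ
  | U => (1, 1)
  | D => (1, -1)
  | F => (2, 0)

theorem one_le_vec_fst (s : SchroederStep) : 1 ≤ s.vec.1 := by
  cases s <;> simp [vec]

instance instFinite : Finite SchroederStep :=
  Finite.of_surjective
    (fun i : Fin 3 => if i = 0 then SchroederStep.U else if i = 1 then SchroederStep.D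
      else SchroederStep.F)
    (by
      intro s
      cases s
      · exact ⟨0, by simp⟩
      · exact ⟨1, by simp⟩
      · exact ⟨2, by simp⟩)

end SchroederStep

/-- The end point of the lattice path that starts at `(0, 0)` and takes the steps of `w` in
order. -/
def pathEnd (w : List SchroederStep) : ℤ × ℤ :=
  (w.map SchroederStep.vec).sum

/-- `w` is a Schroeder path of length `2 * n`: it leads from `(0, 0)` to `(2 * n, 0)` and none of
the points that it visits lies below the `x`-axis. -/
def IsSchroederPath (n : ℕ) (w : List SchroederStep) : Prop :=
  pathEnd w = (2 * (n : ℤ), 0) ∧ ∀ k : ℕ, 0 ≤ (pathEnd (w.take k)).2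

/-- The type of Schroeder paths of length `2 * n`. -/
def SchroederPath (n : ℕ) : Type :=
  {w : List SchroederStep // IsSchroederPath n w}

theorem length_le_pathEnd_fst (w : List SchroederStep) : (w.length : ℤ) ≤ (pathEnd w).1 := by
  induction w with
  | nil => simp [pathEnd]
  | cons s w ih =>
    have h := s.one_le_vec_fst
    simp only [pathEnd, List.map_cons, List.sum_cons, List.length_cons, Prod.fst_add] at ih ⊢
    push_cast
    linarith

instance SchroederPath.instFinite (n : ℕ) : Finite (SchroederPath n) := by
  refine ((List.finite_length_le SchroederStep (2 * n)).subset ?_).to_subtype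
  rintro w ⟨hw, -⟩
  have h := length_le_pathEnd_fst w
  rw [hw] at h
  simp only at h
  simp only [Set.mem_ofPred_eq]
  omega

noncomputable instance SchroederPath.instFintype (n : ℕ) : Fintype (SchroederPath n) :=
  Fintype.ofFinite _

theorem pathEnd_replicate_F (n : ℕ) :
    pathEnd (List.replicate n SchroederStep.F) = (2 * (n : ℤ), 0) := by
  simp [pathEnd, SchroederStep.vec, mul_comm]

instance SchroederPath.instNonempty (n : ℕ) : Nonempty (SchroederPath n) :=
  ⟨⟨List.replicate n SchroederStep.F, pathEnd_replicate_F n, fun k => by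
    rw [List.take_replicate, pathEnd_replicate_F]⟩⟩

/-- Every set of Schroeder paths of a given length is an event. -/
instance SchroederPath.instMeasurableSpace (n : ℕ) : MeasurableSpace (SchroederPath n) := ⊤

/-- The steps of `w` at the positions `i, i + 1, …, j - 1` (counted from `0`) form a nonempty
string of up-steps. -/
def IsUpRun (w : List SchroederStep) (i j : ℕ) : Prop :=
  i < j ∧ ∀ k : ℕ, i ≤ k → k < j → w[k]? = some SchroederStep.U

/-- An ascent: a string of consecutive up-steps that is not contained in a longer one. -/
def IsAscent (w : List SchroederStep) (i j : ℕ) : Prop :=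
  IsUpRun w i j ∧ ∀ i' j' : ℕ, i' ≤ i → j ≤ j' → IsUpRun w i' j' → i' = i ∧ j' = j

/-- The number of ascents of `w`. -/
noncomputable def numAscents (w : List SchroederStep) : ℕ :=
  {p : ℕ × ℕ | IsAscent w p.1 p.2}.ncard

/-- The uniform probability distribution on the Schroeder paths of length `2 * n`. -/
noncomputable def uniformSchroeder (n : ℕ) : Measure (SchroederPath n) :=
  (PMF.uniformOfFintype (SchroederPath n)).toMeasure

/-- The random variable that counts the ascents of a Schroeder path of length `2 * n`. -/
noncomputable def ascentCount (n : ℕ) (w : SchroederPath n) : ℝ :=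
  (numAscents w.1 : ℝ)

/-! Cutting a path at its first return to the axis encodes it as a tree (`equivPath`). A leading `U`
opens a new ascent exactly when the subpath it lifts does not begin with `U` (`numAscents_toList`).
So the series S of counts and A of total ascents satisfy S = 1 + xS + xS² and A = xA + 2xAS + x(1 +
xS)S.

Put D = 1/(1 - x - 2xS), so that (1 - 6x + x²)D² = 1. Both A and x²S' are polynomial-linear in D, so
the total ascents and n times the count are fixed combinations of consecutive coefficients of D
(`two_mul_sum_ascents`, `two_mul_card_ofSize`). The differential equation of D gives a three-term
recurrence, which forces the ratio of these coefficients to tend to ρ = 3 + 2√2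
(`tendsto_delannoy_ratio`). The limit is then (2ρ² - 5ρ + 1)/((ρ - 3)ρ²) = √2 - 1. -/

/-- The shapes of Schroeder paths, decomposed at the first return to the axis. -/
inductive SchroederTree : Type
  | nil : SchroederTree
  | flat : SchroederTree → SchroederTree
  | node : SchroederTree → SchroederTree → SchroederTree

namespace SchroederTree

/-- The semilength of the path that a tree encodes. -/
def size : SchroederTree → ℕ
  | nil => 0
  | flat t => t.size + 1
  | node a b => a.size + b.size + 1

/-- The path that a tree encodes. -/
def toList : SchroederTree → List SchroederStep
  | nil => []
  | flat t => SchroederStep.F :: t.toList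
  | node a b => SchroederStep.U :: (a.toList ++ SchroederStep.D :: b.toList)

/-- `1` if the encoded path does not begin with an up-step, and `0` otherwise. -/
def noUp : SchroederTree → ℕ
  | nil => 1
  | flat _ => 1
  | node _ _ => 0

/-- The number of ascents of the encoded path. -/
def ascents : SchroederTree → ℕ
  | nil => 0
  | flat t => t.ascents
  | node a b => a.ascents + b.ascents + a.noUp

end SchroederTree

theorem pathEnd_nil : pathEnd [] = 0 := rfl

theorem pathEnd_cons (s : SchroederStep) (w : List SchroederStep) :
    pathEnd (s :: w) = s.vec + pathEnd w := by
  simp [pathEnd]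

theorem pathEnd_append (v w : List SchroederStep) :
    pathEnd (v ++ w) = pathEnd v + pathEnd w := by
  simp [pathEnd]

/-! ### Bijection between trees and paths -/

namespace SchroederTree

theorem pathEnd_toList (t : SchroederTree) : pathEnd t.toList = (2 * (t.size : ℤ), 0) := by
  induction t with
  | nil => simp [toList, size, pathEnd, Prod.ext_iff]
  | flat t ih =>
    simp only [toList, pathEnd_cons, ih, size, SchroederStep.vec]
    ext <;> simp
    ring
  | node a b iha ihb =>
    simp only [toList, pathEnd_cons, pathEnd_append, iha, ihb, size, SchroederStep.vec]
    ext <;> simp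
    ring

theorem pathEnd_take_toList_nonneg (t : SchroederTree) (k : ℕ) :
    0 ≤ (pathEnd (t.toList.take k)).2 := by
  induction t generalizing k with
  | nil => simp [toList, pathEnd]
  | flat t ih =>
    cases k with
    | zero => simp [pathEnd]
    | succ k => simpa [toList, pathEnd_cons, SchroederStep.vec] using ih k
  | node a b iha ihb =>
    cases k with
    | zero => simp [pathEnd]
    | succ k =>
      simp only [toList, List.take_succ_cons, pathEnd_cons, List.take_append, pathEnd_append,
        SchroederStep.vec, Prod.snd_add]
      have ha := iha k
      rcases hk : k - a.toList.length with _ | m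
      · simp only [List.take_zero, pathEnd_nil, Prod.snd_zero]
        omega
      · have hb := ihb m
        rw [List.take_of_length_le (by omega), pathEnd_toList]
        simp only [List.take_succ_cons, pathEnd_cons, SchroederStep.vec, Prod.snd_add]
        omega

theorem isSchroederPath_toList (t : SchroederTree) : IsSchroederPath t.size t.toList :=
  ⟨t.pathEnd_toList, t.pathEnd_take_toList_nonneg⟩

/-- Unique parsing. The tails are needed for the induction: inside a `node`, the first subtree is
followed by `D`. -/
theorem toList_append_inj (a b : SchroederTree) (u v : List SchroederStep)
    (hu : u.head? = none ∨ u.head? = some SchroederStep.D)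
    (hv : v.head? = none ∨ v.head? = some SchroederStep.D)
    (h : a.toList ++ u = b.toList ++ v) : a = b ∧ u = v := by
  induction a generalizing b u v with
  | nil =>
    cases b with
    | nil => simpa [toList] using h
    | flat b => simp only [toList, List.nil_append, List.cons_append] at h; subst h; simp at hu
    | node b c => simp only [toList, List.nil_append, List.cons_append] at h; subst h; simp at hu
  | flat a ih =>
    cases b with
    | nil => simp only [toList, List.nil_append, List.cons_append] at h; subst h; simp at hv
    | flat b =>
      simp only [toList, List.cons_append, List.cons.injEq, true_and] at h
      obtain ⟨rfl, rfl⟩ := ih b u v hu hv h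
      exact ⟨rfl, rfl⟩
    | node b c => simp [toList] at h
  | node a a' iha iha' =>
    cases b with
    | nil => simp only [toList, List.nil_append, List.cons_append] at h; subst h; simp at hv
    | flat b => simp [toList] at h
    | node b b' =>
      simp only [toList, List.cons_append, List.append_assoc, List.cons.injEq, true_and] at h
      obtain ⟨rfl, h'⟩ := iha b _ _ (by simp) (by simp) h
      simp only [List.cons.injEq, true_and] at h'
      obtain ⟨rfl, rfl⟩ := iha' b' u v hu hv h'
      exact ⟨rfl, rfl⟩

theorem toList_injective : Function.Injective toList := fun a b h =>
  (toList_append_inj a b [] [] (by simp) (by simp) (by simpa using h)).1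

/-- Greedy parsing stops only at a `D` or at the end. After a `U`, the final height being at most 0
guarantees the matching `D`. -/
theorem exists_toList_append (n : ℕ) (w : List SchroederStep) (hn : w.length ≤ n)
    (h : (pathEnd w).2 ≤ 0) :
    ∃ (t : SchroederTree) (u : List SchroederStep), w = t.toList ++ u ∧
      (u = [] ∨ ∃ u', u = SchroederStep.D :: u') := by
  induction n generalizing w with
  | zero => exact ⟨nil, [], by simpa [toList] using hn, Or.inl rfl⟩
  | succ n ih =>
    rcases w with _ | ⟨s, w⟩
    · exact ⟨nil, [], rfl, Or.inl rfl⟩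
    simp only [pathEnd_cons, Prod.snd_add] at h
    simp only [List.length_cons] at hn
    cases s with
    | D => exact ⟨nil, _, rfl, Or.inr ⟨w, rfl⟩⟩
    | F =>
      obtain ⟨t, u, rfl, hu⟩ := ih w (by omega) (by simpa [SchroederStep.vec] using h)
      exact ⟨flat t, u, rfl, hu⟩
    | U =>
      simp only [SchroederStep.vec] at h
      obtain ⟨a, u, rfl, hu⟩ := ih w (by omega) (by omega)
      simp only [pathEnd_append, pathEnd_toList, Prod.snd_add] at h
      obtain rfl | ⟨u, rfl⟩ := hu
      · simp [pathEnd] at h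
      simp only [pathEnd_cons, SchroederStep.vec, Prod.snd_add] at h
      simp only [List.length_append, List.length_cons] at hn
      obtain ⟨b, v, rfl, hv⟩ := ih u (by omega) (by omega)
      exact ⟨node a b, v, by simp [toList], hv⟩

theorem exists_toList_eq {n : ℕ} {w : List SchroederStep} (hw : IsSchroederPath n w) :
    ∃ t : SchroederTree, t.size = n ∧ t.toList = w := by
  obtain ⟨t, u, rfl, hu⟩ := exists_toList_append _ w le_rfl (by rw [hw.1])
  obtain rfl | ⟨u, rfl⟩ := hu
  · have h := hw.1
    rw [List.append_nil, pathEnd_toList, Prod.mk.injEq] at h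
    exact ⟨t, by omega, by simp⟩
  -- The prefix that includes this extra `D` ends at height -1.
  · have h := hw.2 (t.toList.length + 1)
    rw [List.take_append, List.take_of_length_le (by omega), pathEnd_append, pathEnd_toList] at h
    simp [pathEnd, SchroederStep.vec] at h

/-- The trees of size `n` correspond to the Schroeder paths of length `2 * n`. -/
noncomputable def equivPath (n : ℕ) : {t : SchroederTree // t.size = n} ≃ SchroederPath n :=
  Equiv.ofBijective
    (fun t => ⟨t.1.toList, by have h := t.1.isSchroederPath_toList; rwa [t.2] at h⟩)
    ⟨fun _ _ h => Subtype.ext (toList_injective (congrArg Subtype.val h)), fun w => by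
      obtain ⟨t, ht, hw⟩ := exists_toList_eq w.2
      exact ⟨⟨t, ht⟩, Subtype.ext hw⟩⟩

theorem finite_size_eq (n : ℕ) : {t : SchroederTree | t.size = n}.Finite :=
  Set.finite_coe_iff.mp (Finite.of_equiv _ (equivPath n).symm)

end SchroederTree

/-! ### Summation over trees of given size -/

namespace SchroederTree

/-- The trees of size `n`. -/
noncomputable def ofSize (n : ℕ) : Finset SchroederTree := (finite_size_eq n).toFinset

@[simp]
theorem mem_ofSize {n : ℕ} {t : SchroederTree} : t ∈ ofSize n ↔ t.size = n := by
  simp [ofSize]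

theorem ofSize_zero : ofSize 0 = {nil} := by
  ext t
  cases t <;> simp [size]

open Classical in
theorem ofSize_succ (n : ℕ) : ofSize (n + 1) = (ofSize n).image flat ∪
    (Finset.HasAntidiagonal.antidiagonal n).biUnion
      fun p => (ofSize p.1 ×ˢ ofSize p.2).image fun q => node q.1 q.2 := by
  ext t
  cases t <;> simp [size]

theorem sum_ofSize_succ {M : Type*} [AddCommMonoid M] (n : ℕ) (f : SchroederTree → M) :
    ∑ t ∈ ofSize (n + 1), f t = ∑ t ∈ ofSize n, f (flat t) +
      ∑ p ∈ Finset.HasAntidiagonal.antidiagonal n,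
        ∑ a ∈ ofSize p.1, ∑ b ∈ ofSize p.2, f (node a b) := by
  classical
  rw [ofSize_succ, Finset.sum_union, Finset.sum_image, Finset.sum_biUnion]
  · congr 1
    refine Finset.sum_congr rfl fun p _ => ?_
    rw [Finset.sum_image, Finset.sum_product]
    rintro ⟨a, b⟩ _ ⟨c, d⟩ _ h
    simpa using h
  · intro p _ q _ hpq
    simp only [Function.onFun, Finset.disjoint_left, Finset.mem_image, Finset.mem_product,
      mem_ofSize, not_exists, not_and]
    rintro _ ⟨⟨a, b⟩, h, rfl⟩ ⟨c, d⟩ h' h''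
    simp only [node.injEq] at h''
    obtain ⟨rfl, rfl⟩ := h''
    exact hpq (Prod.ext (h.1.symm.trans h'.1) (h.2.symm.trans h'.2))
  · intro a _ b _ h
    simpa using h
  · simp only [Finset.disjoint_left, Finset.mem_image, Finset.mem_biUnion, not_exists, not_and]
    rintro _ ⟨a, _, rfl⟩ p _ q _ h
    simp at h

end SchroederTree

/-! ### Ascents of paths and of trees -/

/-- The positions at which the ascents of `w` end. -/
def ascentEnds (w : List SchroederStep) : Set ℕ :=
  {k | w[k]? = some SchroederStep.U ∧ w[k + 1]? ≠ some SchroederStep.U}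

theorem finite_ascentEnds (w : List SchroederStep) : (ascentEnds w).Finite := by
  refine (Set.finite_lt_nat w.length).subset fun k hk => ?_
  by_contra h
  have h0 := hk.1
  rw [List.getElem?_eq_none (by simpa using h)] at h0
  simp at h0

/-- By maximality an ascent is determined by its last position, which is recognised locally. -/
theorem numAscents_eq_ncard_ascentEnds (w : List SchroederStep) :
    numAscents w = (ascentEnds w).ncard := by
  unfold numAscents
  refine Set.ncard_congr (fun p _ => p.2 - 1) ?_ ?_ ?_
  · rintro ⟨i, j⟩ ⟨⟨hij, h⟩, hmax⟩
    simp only at hij h hmax ⊢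
    refine ⟨h _ (by omega) (by omega), fun hj => ?_⟩
    rw [Nat.sub_add_cancel (by omega)] at hj
    have := (hmax i (j + 1) le_rfl (by omega) ⟨by omega, fun k hk hk' => ?_⟩).2
    · omega
    · rcases Nat.lt_succ_iff_lt_or_eq.mp hk' with hk' | rfl
      exacts [h k hk hk', hj]
  · rintro ⟨i, j⟩ ⟨i', j'⟩ ⟨⟨hij, h⟩, hmax⟩ ⟨⟨hij', h'⟩, hmax'⟩ he
    simp only at hij h hmax hij' h' hmax' he
    obtain rfl : j = j' := by omega
    rcases le_total i i' with hi | hi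
    · rw [(hmax' i j hi le_rfl ⟨hij, h⟩).1]
    · rw [(hmax i' j hi le_rfl ⟨hij', h'⟩).1]
  · intro k hk
    classical
    have hex : ∃ i, IsUpRun w i (k + 1) := ⟨k, by omega, fun m h1 h2 => by
      obtain rfl : m = k := by omega
      exact hk.1⟩
    refine ⟨(Nat.find hex, k + 1), ⟨Nat.find_spec hex, fun i' j' hi hj h => ?_⟩, rfl⟩
    have hlt := (Nat.find_spec hex).1
    simp only at hi hj
    obtain rfl : j' = k + 1 := by
      by_contra hne
      exact hk.2 (h.2 (k + 1) (by omega) (by omega))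
    exact ⟨le_antisymm hi (Nat.find_min' hex h), rfl⟩

theorem ascentEnds_cons (s : SchroederStep) (w : List SchroederStep) :
    ascentEnds (s :: w) = Nat.succ '' ascentEnds w ∪
      {k | k = 0 ∧ s = SchroederStep.U ∧ w.head? ≠ some SchroederStep.U} := by
  ext k
  cases k <;> simp [ascentEnds, List.head?_eq_getElem?]

theorem numAscents_nil : numAscents [] = 0 := by
  simp [numAscents_eq_ncard_ascentEnds, ascentEnds]

theorem numAscents_cons_of_not {s : SchroederStep} {w : List SchroederStep}
    (h : ¬(s = SchroederStep.U ∧ w.head? ≠ some SchroederStep.U)) :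
    numAscents (s :: w) = numAscents w := by
  rw [numAscents_eq_ncard_ascentEnds, numAscents_eq_ncard_ascentEnds, ascentEnds_cons]
  simp only [h, and_false, Set.ofPred_false, Set.union_empty]
  exact Set.ncard_image_of_injective _ Nat.succ_injective

theorem numAscents_U_cons {w : List SchroederStep} (h : w.head? ≠ some SchroederStep.U) :
    numAscents (SchroederStep.U :: w) = numAscents w + 1 := by
  rw [numAscents_eq_ncard_ascentEnds, numAscents_eq_ncard_ascentEnds, ascentEnds_cons]
  have hs : {k : ℕ | k = 0 ∧ SchroederStep.U = SchroederStep.U ∧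
      w.head? ≠ some SchroederStep.U} = {0} := by
    ext k
    simp [h]
  rw [hs, Set.union_singleton, Set.ncard_insert_of_notMem (by simp)
    ((finite_ascentEnds w).image _), Set.ncard_image_of_injective _ Nat.succ_injective]

theorem numAscents_append_D_cons (v w : List SchroederStep) :
    numAscents (v ++ SchroederStep.D :: w) = numAscents v + numAscents w := by
  induction v with
  | nil => rw [List.nil_append, numAscents_nil, numAscents_cons_of_not (by simp), zero_add]
  | cons s v ih =>
    have hh : (v ++ SchroederStep.D :: w).head? = some SchroederStep.U ↔
        v.head? = some SchroederStep.U := by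
      cases v <;> simp
    rw [List.cons_append]
    by_cases h : s = SchroederStep.U ∧ v.head? ≠ some SchroederStep.U
    · obtain ⟨rfl, h⟩ := h
      rw [numAscents_U_cons h, numAscents_U_cons (by rwa [Ne, hh]), ih]
      ring
    · rw [numAscents_cons_of_not h, numAscents_cons_of_not (by rwa [Ne, hh]), ih]

theorem SchroederTree.numAscents_toList (t : SchroederTree) :
    numAscents t.toList = t.ascents := by
  induction t with
  | nil => exact numAscents_nil
  | flat t ih => rw [toList, ascents, numAscents_cons_of_not (by simp), ih]
  | node a b iha ihb =>
    rw [toList, ascents]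
    cases a with
    | node a a' =>
      rw [numAscents_cons_of_not (by simp [toList]), numAscents_append_D_cons, iha, ihb]
      simp [noUp]
    | _ =>
      rw [numAscents_U_cons (by simp [toList]), numAscents_append_D_cons, iha, ihb]
      simp [noUp]

/-! ### Generating functions -/

namespace SchroederTree

open PowerSeries

/-- The generating function of the Schroeder numbers. -/
noncomputable def countSeries : ℝ⟦X⟧ := .mk fun n => ((ofSize n).card : ℝ)

/-- The generating function of the total number of ascents. -/
noncomputable def ascentSeries : ℝ⟦X⟧ := .mk fun n => ∑ t ∈ ofSize n, (t.ascents : ℝ)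

/-- The generating function of the paths that do not begin with an up-step. -/
noncomputable def noUpSeries : ℝ⟦X⟧ := .mk fun n => ∑ t ∈ ofSize n, (t.noUp : ℝ)

/-- The generating function of the central Delannoy numbers. -/
noncomputable def delannoySeries : ℝ⟦X⟧ := (1 - X - 2 * X * countSeries)⁻¹

theorem countSeries_eq :
    countSeries = 1 + X * countSeries + X * (countSeries * countSeries) := by
  ext n
  cases n with
  | zero => simp [countSeries, ofSize_zero]
  | succ n =>
    simp only [map_add, coeff_succ_X_mul]
    simp only [coeff_mul, coeff_one, countSeries, coeff_mk]
    have h := sum_ofSize_succ n fun _ => (1 : ℝ)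
    simpa using h

theorem noUpSeries_eq : noUpSeries = 1 + X * countSeries := by
  ext n
  cases n with
  | zero => simp [noUpSeries, ofSize_zero, noUp]
  | succ n =>
    simp only [map_add, coeff_succ_X_mul, coeff_one, countSeries, noUpSeries, coeff_mk]
    simp [sum_ofSize_succ, noUp]

theorem ascentSeries_eq : ascentSeries = X * ascentSeries + X * (ascentSeries * countSeries) +
    X * (countSeries * ascentSeries) + X * (noUpSeries * countSeries) := by
  ext n
  cases n with
  | zero => simp [ascentSeries, ofSize_zero, ascents]
  | succ n =>
    simp only [map_add, coeff_succ_X_mul]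
    simp only [coeff_mul, countSeries, noUpSeries, ascentSeries, coeff_mk, sum_ofSize_succ,
      ascents, add_assoc]
    congr 1
    simp only [← Finset.sum_add_distrib]
    refine Finset.sum_congr rfl fun p _ => ?_
    simp only [Nat.cast_add, Finset.sum_add_distrib, Finset.sum_const, nsmul_eq_mul,
      Finset.sum_mul, Finset.mul_sum]
    simp only [mul_comm]

theorem mul_delannoySeries : (1 - X - 2 * X * countSeries) * delannoySeries = 1 :=
  PowerSeries.mul_inv_cancel _ (by simp)

/-- Solving for A gives A = D·xS(1 + xS); the quadratic for S removes S², and 2xS·D = (1 - x)D - 1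
removes S. -/
theorem ascentSeries_eq_delannoySeries :
    2 * ascentSeries + 2 + 5 * (X * delannoySeries) =
      2 * delannoySeries + X * (X * delannoySeries) + X := by
  have h2 := ascentSeries_eq
  rw [noUpSeries_eq] at h2
  linear_combination (-2 * ascentSeries - 2 + X) * mul_delannoySeries + 2 * delannoySeries * h2 -
    2 * delannoySeries * X * countSeries_eq

/-- Differentiating the quadratic gives S' = D(S + S²), where x(S + S²) = S - 1. -/
theorem derivative_countSeries :
    2 * (X * (X * derivative ℝ countSeries)) + 1 + 3 * (X * delannoySeries) = delannoySeries := by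
  have h := congrArg (derivative ℝ) countSeries_eq
  simp only [map_add, Derivation.leibniz, smul_eq_mul, derivative_X, Derivation.map_one_eq_zero]
    at h
  linear_combination (-2 * X ^ 2 * derivative ℝ countSeries - 1) * mul_delannoySeries +
    2 * X ^ 2 * delannoySeries * h - 2 * delannoySeries * X * countSeries_eq

theorem derivative_delannoySeries :
    2 * derivative ℝ delannoySeries + 2 * (X * (X * derivative ℝ delannoySeries)) +
      2 * (X * delannoySeries) = 12 * (X * derivative ℝ delannoySeries) + 6 * delannoySeries := by
  -- The square of 1 - x - 2xS is the discriminant of the quadratic for S.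
  have hP : (1 - ((6 : ℕ) : ℝ⟦X⟧) * X + X * X) * (delannoySeries * delannoySeries) = 1 := by
    push_cast
    linear_combination ((1 - X - 2 * X * countSeries) * delannoySeries + 1) * mul_delannoySeries +
      4 * X * delannoySeries ^ 2 * countSeries_eq
  have h := congrArg (derivative ℝ) hP
  simp only [map_add, map_sub, Derivation.leibniz, smul_eq_mul, derivative_X,
    Derivation.map_one_eq_zero, Derivation.map_natCast] at h
  push_cast at h
  -- Multiplying by D⁻¹ cancels one factor D from P'D² + 2PDD' = 0, where P = 1 - 6x + x².
  linear_combination (1 - X - 2 * X * countSeries) * h -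
    2 * ((X - 3) * delannoySeries + (1 - 6 * X + X ^ 2) * derivative ℝ delannoySeries) *
      mul_delannoySeries

/-! ### Coefficient identities -/

theorem coeff_ofNat_mul (n k : ℕ) [k.AtLeastTwo] (f : ℝ⟦X⟧) :
    coeff n ((ofNat(k) : ℝ⟦X⟧) * f) = (ofNat(k) : ℝ) * coeff n f := by
  have h : (ofNat(k) : ℝ⟦X⟧) = C (ofNat(k) : ℝ) := (map_ofNat C k).symm
  rw [h, coeff_C_mul]

/-- The central Delannoy numbers. -/
noncomputable def delannoy (n : ℕ) : ℝ := coeff n delannoySeries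

theorem coeff_X_mul_derivative (n : ℕ) (f : ℝ⟦X⟧) :
    coeff n (X * derivative ℝ f) = n * coeff n f := by
  cases n with
  | zero => simp
  | succ n => rw [coeff_succ_X_mul, coeff_derivative]; push_cast; ring

theorem delannoy_zero : delannoy 0 = 1 := by
  have h := congrArg (coeff 0) derivative_countSeries
  simp only [map_add, coeff_ofNat_mul, coeff_zero_X_mul, coeff_zero_one] at h
  rw [delannoy, ← h]
  ring

theorem two_mul_card_ofSize (n : ℕ) :
    2 * (n * ((ofSize n).card : ℝ)) = delannoy (n + 1) - 3 * delannoy n := by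
  have h := congrArg (coeff (n + 1)) derivative_countSeries
  simp only [map_add, coeff_ofNat_mul, coeff_succ_X_mul, coeff_X_mul_derivative, coeff_one,
    Nat.add_eq_zero_iff, one_ne_zero, and_false, if_false] at h
  simp only [countSeries, coeff_mk] at h
  simp only [delannoy]
  linarith

theorem delannoy_one : delannoy 1 = 3 := by
  have h := two_mul_card_ofSize 0
  rw [delannoy_zero] at h
  norm_num at h
  linarith

theorem delannoy_recurrence (n : ℕ) :
    (n + 2) * delannoy (n + 2) = (6 * n + 9) * delannoy (n + 1) - (n + 1) * delannoy n := by
  have h := congrArg (coeff (n + 1)) derivative_delannoySeries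
  simp only [map_add, coeff_ofNat_mul, coeff_succ_X_mul, coeff_X_mul_derivative] at h
  simp only [coeff_derivative] at h
  push_cast at h
  simp only [delannoy]
  linarith

theorem two_mul_sum_ascents (n : ℕ) : 2 * ∑ t ∈ ofSize (n + 2), (t.ascents : ℝ) =
    2 * delannoy (n + 2) - 5 * delannoy (n + 1) + delannoy n := by
  have h := congrArg (coeff (n + 2)) ascentSeries_eq_delannoySeries
  have h2 : coeff (n + 2) (2 : ℝ⟦X⟧) = 0 := by
    rw [← mul_one (2 : ℝ⟦X⟧), coeff_ofNat_mul, coeff_one]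
    simp
  simp only [map_add, coeff_ofNat_mul, coeff_succ_X_mul, coeff_X, h2] at h
  rw [if_neg (by omega)] at h
  simp only [ascentSeries, coeff_mk] at h
  simp only [delannoy]
  linarith

/-! ### Limit of the ratios -/

theorem delannoy_growth (n : ℕ) : 0 < delannoy n ∧ 3 * delannoy n ≤ delannoy (n + 1) := by
  induction n with
  | zero => norm_num [delannoy_zero, delannoy_one]
  | succ n ih =>
    have hpos : 0 < delannoy (n + 1) := by linarith
    refine ⟨hpos, ?_⟩
    have h := delannoy_recurrence n
    have hn : (0 : ℝ) ≤ n := n.cast_nonneg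
    have h1 := mul_le_mul_of_nonneg_left ih.2 (by positivity : (0 : ℝ) ≤ n + 1)
    have h2 : 0 ≤ (n : ℝ) * delannoy (n + 1) := by positivity
    refine le_of_mul_le_mul_left (a := (n : ℝ) + 2) ?_ (by positivity)
    rw [h]
    nlinarith

/-- The recurrence reads r ↦ (6n + 9 - (n + 1)/r)/(n + 2), a perturbation of r ↦ 6 - 1/r, which
fixes ρ = 3 + 2√2 and contracts on r ≥ 3. -/
theorem abs_delannoy_ratio_sub_le (n : ℕ) :
    |delannoy (n + 1) / delannoy n - (3 + 2 * √2)| ≤ 4 / (n + 1) := by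
  have hs : √2 ^ 2 = 2 := Real.sq_sqrt (by norm_num)
  have hs1 : 1.4 < √2 := by
    rw [Real.lt_sqrt (by norm_num)]
    norm_num
  have hs2 : √2 < 1.5 := by
    rw [Real.sqrt_lt' (by norm_num)]
    norm_num
  induction n with
  | zero =>
    rw [delannoy_zero, delannoy_one, abs_le]
    norm_num at *
    constructor <;> linarith
  | succ n ih =>
    obtain ⟨h0, h1⟩ := delannoy_growth n
    obtain ⟨hpos, -⟩ := delannoy_growth (n + 1)
    have h := delannoy_recurrence n
    set r := delannoy (n + 1) / delannoy n with hr
    have hr3 : 3 ≤ r := by rwa [hr, le_div_iff₀ h0]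
    have hd : delannoy (n + 1) = r * delannoy n := by rw [hr]; field_simp
    have hn : (0 : ℝ) ≤ n := n.cast_nonneg
    -- Uses 1/ρ = 3 - 2√2 and 6 - ρ = 1/ρ; the term -2√2 is 3 - ρ.
    have key : delannoy (n + 1 + 1) / delannoy (n + 1) - (3 + 2 * √2) =
        ((n + 1) * ((r - (3 + 2 * √2)) * ((3 - 2 * √2) / r)) - 2 * √2) / (n + 2) := by
      have h2 : delannoy (n + 1 + 1) = ((6 * n + 9) * r - (n + 1)) * delannoy n / (n + 2) := by
        rw [eq_div_iff (by positivity), mul_comm, h, hd]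
        ring
      rw [h2, hd]
      field_simp
      linear_combination (-4 * ((n : ℝ) + 1)) * hs
    have hq : |(3 - 2 * √2) / r| ≤ 1 / 15 := by
      rw [abs_of_nonneg (div_nonneg (by linarith) (by linarith)), div_le_iff₀ (by linarith)]
      linarith
    have hm : |(n + 1 : ℝ) * ((r - (3 + 2 * √2)) * ((3 - 2 * √2) / r))| ≤ 4 / 15 := by
      rw [abs_mul, abs_mul, abs_of_nonneg (by positivity : (0 : ℝ) ≤ n + 1)]
      calc (n + 1 : ℝ) * (|r - (3 + 2 * √2)| * |(3 - 2 * √2) / r|)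
          ≤ (n + 1 : ℝ) * (4 / (n + 1) * (1 / 15)) := by gcongr
        _ = 4 / 15 := by field_simp
    rw [key, abs_div, abs_of_pos (by positivity : (0 : ℝ) < n + 2)]
    push_cast
    rw [add_assoc, one_add_one_eq_two]
    -- The constant 4 closes the induction because 4/15 + 2√2 < 4.
    gcongr
    rw [abs_le] at hm ⊢
    constructor <;> linarith [hm.1, hm.2]

theorem tendsto_delannoy_ratio :
    Tendsto (fun n => delannoy (n + 1) / delannoy n) atTop (nhds (3 + 2 * √2)) := by
  rw [tendsto_iff_norm_sub_tendsto_zero]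
  refine squeeze_zero (fun _ => norm_nonneg _) abs_delannoy_ratio_sub_le ?_
  have h := (tendsto_one_div_add_atTop_nhds_zero_nat (𝕜 := ℝ)).const_mul 4
  simpa [div_eq_mul_inv] using h

theorem tendsto_sum_ascents_div : Tendsto
    (fun n : ℕ => (∑ t ∈ ofSize n, (t.ascents : ℝ)) / (n * ((ofSize n).card : ℝ))) atTop
    (nhds (√2 - 1)) := by
  rw [← tendsto_add_atTop_iff_nat 2]
  have h0 := tendsto_delannoy_ratio
  have h1 := (tendsto_add_atTop_iff_nat 1).mpr h0
  have h2 := (tendsto_add_atTop_iff_nat 2).mpr h0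
  have hs : √2 ^ 2 = 2 := Real.sq_sqrt (by norm_num)
  have hpos : 0 < √2 := by positivity
  -- Numerator and denominator are both divided by `delannoy n`, leaving only ratios.
  have hlim := ((((h1.mul h0).const_mul 2).sub (h0.const_mul 5)).add_const 1).div
    ((h2.sub_const 3).mul (h1.mul h0)) (by simp; positivity)
  convert hlim using 1
  · ext n
    have hn0 := (delannoy_growth n).1
    have hn1 := (delannoy_growth (n + 1)).1
    have hn2 := (delannoy_growth (n + 2)).1
    have ha := two_mul_sum_ascents n
    have hc := two_mul_card_ofSize (n + 2)
    rw [← mul_div_mul_left _ _ (two_ne_zero' ℝ), ha, hc]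
    simp only [Pi.div_apply]
    have e1 : (delannoy (n + 1 + 1) / delannoy (n + 1)) * (delannoy (n + 1) / delannoy n) =
        delannoy (n + 2) / delannoy n := by field_simp
    rw [e1]
    have e2 : delannoy (n + 2 + 1) / delannoy (n + 2) - 3 =
        (delannoy (n + 2 + 1) - 3 * delannoy (n + 2)) / delannoy (n + 2) := by field_simp
    have e3 : 2 * (delannoy (n + 2) / delannoy n) - 5 * (delannoy (n + 1) / delannoy n) + 1 =
        (2 * delannoy (n + 2) - 5 * delannoy (n + 1) + delannoy n) / delannoy n := by field_simp
    rw [e2, e3, div_mul_div_cancel₀ hn2.ne', div_div_div_cancel_right₀ hn0.ne']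
  · congr 1
    rw [eq_div_iff (by simp; positivity)]
    linear_combination (8 * √2 ^ 2 + 16 * √2 + 2) * hs

end SchroederTree

/-! ### The expectation -/

theorem SchroederPath.sum_eq_sum_ofSize (n : ℕ) (f : List SchroederStep → ℝ) :
    ∑ w : SchroederPath n, f w.1 = ∑ t ∈ SchroederTree.ofSize n, f t.toList := by
  have : Fintype {t : SchroederTree // t.size = n} :=
    Fintype.ofEquiv _ (SchroederTree.equivPath n).symm
  rw [Finset.sum_subtype _ (fun t => SchroederTree.mem_ofSize),
    ← (SchroederTree.equivPath n).sum_comp]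
  rfl

theorem integral_ascentCount (n : ℕ) : ∫ w, ascentCount n w ∂(uniformSchroeder n) =
    (∑ t ∈ SchroederTree.ofSize n, (t.ascents : ℝ)) / ((SchroederTree.ofSize n).card : ℝ) := by
  have hc : (Fintype.card (SchroederPath n) : ℝ) = (SchroederTree.ofSize n).card := by
    simpa using SchroederPath.sum_eq_sum_ofSize n fun _ => 1
  have hs : ∑ w : SchroederPath n, ascentCount n w =
      ∑ t ∈ SchroederTree.ofSize n, (t.ascents : ℝ) := by
    simpa [SchroederTree.numAscents_toList, ascentCount] using
      SchroederPath.sum_eq_sum_ofSize n fun w => (numAscents w : ℝ)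
  have : MeasurableSingletonClass (SchroederPath n) := ⟨fun _ => trivial⟩
  rw [uniformSchroeder, PMF.integral_eq_sum, ← hs, ← hc, Finset.sum_div]
  refine Finset.sum_congr rfl fun w _ => ?_
  rw [PMF.uniformOfFintype_apply, smul_eq_mul, ENNReal.toReal_inv, ENNReal.toReal_natCast,
    div_eq_inv_mul]

theorem theorem4 :
    (fun n : ℕ => ∫ w, ascentCount n w ∂(uniformSchroeder n)) ~[atTop]
      (fun n : ℕ => (Real.sqrt 2 - 1) * (n : ℝ)) := by
  have hc : Real.sqrt 2 - 1 ≠ 0 := by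
    have h : (1 : ℝ) < Real.sqrt 2 := by
      rw [Real.lt_sqrt (by norm_num)]
      norm_num
    linarith
  refine isEquivalent_of_tendsto_one ?_
  have h := SchroederTree.tendsto_sum_ascents_div.div_const (Real.sqrt 2 - 1)
  rw [div_self hc] at h
  refine h.congr fun n => ?_
  simp only [Pi.div_apply, integral_ascentCount]
  rw [div_div, div_div]
  congr 1
  ring
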